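/- Let $N\ge 3$ be an integer and $0<s<1$, and put $2_s^*=\frac{2N}{N-2s}$ and $2^*=\frac{2N}{N-2}$. Let $X$ be the completion of $C_c^\infty(\mathbb{R}^N)$ (real-valued functions) under the norm $$\|u\|_X=\left(\int_{\mathbb{R}^N}|\nabla u|^2\,dx+\int_{\mathbb{R}^N}\int_{\mathbb{R}^N}\frac{|u(x)-u(y)|^2}{|x-y|^{N+2s}}\,dx\,dy\right)^{1/2},$$ regarded, through the Sobolev embedding, as a space of functions in $L^{2^*}(\mathbb{R}^N)$. Let $q\in(2_s^*,2^*)$ and let $(u_n)$ be a bounded sequence in $X$ such that $\lim_{n\to\infty}\int_{\mathbb{R}^N}|u_n|^q\,dx$ exists and is positive. Then there exist points $z_n\in\mathbb{R}^N$ and a function $\bar u\in L^q_{\mathrm{loc}}(\mathbb{R}^N)$ with $\bar u\not\equiv 0$ (that is, $\bar u$ is not almost everywhere zero) such that, up to a subsequence, the translates $\bar u_n:=u_n(\cdot+z_n)$ converge to $\bar u$ strongly in $L^q_{\mathrm{loc}}(\mathbb{R}^N)$. -/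

import Mathlib

open MeasureTheory Filter Topology
open scoped ENNReal NNReal ContDiff

namespace MixedSobolev

/-- `φ ∈ C_c^∞(ℝ^N)`, real valued. -/
def IsTestFunction {N : ℕ} (φ : EuclideanSpace ℝ (Fin N) → ℝ) : Prop :=
  ContDiff ℝ ∞ φ ∧ HasCompactSupport φ

/-- `G` is the weak (distributional) gradient of `u` on `ℝ^N`:
`∫ u ∂_v ψ = - ∫ ⟨G, v⟩ ψ` for all directions `v` and all test functions `ψ`. -/
def HasWeakGradient {N : ℕ} (u : EuclideanSpace ℝ (Fin N) → ℝ)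
    (G : EuclideanSpace ℝ (Fin N) → EuclideanSpace ℝ (Fin N)) : Prop :=
  LocallyIntegrable u volume ∧ LocallyIntegrable G volume ∧
    ∀ ψ : EuclideanSpace ℝ (Fin N) → ℝ, IsTestFunction ψ → ∀ v : EuclideanSpace ℝ (Fin N),
      ∫ x, u x * fderiv ℝ ψ x v = - ∫ x, inner ℝ (G x) v * ψ x

/-- The Dirichlet energy `∫ |∇u|² dx ∈ [0, ∞]`. The weak gradient is unique up to a null set, so
the infimum runs over one value, and it is `∞` if `u` has no weak gradient. -/
noncomputable def dirichletEnergy {N : ℕ} (u : EuclideanSpace ℝ (Fin N) → ℝ) : ℝ≥0∞ :=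
  ⨅ (G : EuclideanSpace ℝ (Fin N) → EuclideanSpace ℝ (Fin N)) (_ : HasWeakGradient u G),
    ∫⁻ x, ‖G x‖ₑ ^ 2

/-- The Gagliardo energy `∬ |u(x) - u(y)|² / |x - y|^{N + 2s} dx dy ∈ [0, ∞]`. -/
noncomputable def gagliardoEnergy {N : ℕ} (s : ℝ) (u : EuclideanSpace ℝ (Fin N) → ℝ) : ℝ≥0∞ :=
  ∫⁻ x, ∫⁻ y, ‖u x - u y‖ₑ ^ 2 / ENNReal.ofReal (‖x - y‖ ^ ((N : ℝ) + 2 * s))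

/-- `‖u‖_X = (∫ |∇u|² + ∬ |u(x) - u(y)|² / |x - y|^{N + 2s})^{1/2} ∈ [0, ∞]`. -/
noncomputable def xNorm {N : ℕ} (s : ℝ) (u : EuclideanSpace ℝ (Fin N) → ℝ) : ℝ≥0∞ :=
  (dirichletEnergy u + gagliardoEnergy s u) ^ (1 / 2 : ℝ)

/-- The critical exponent `2N / (N - 2s)`; the value `s = 1` gives `2^* = 2N / (N - 2)`. -/
noncomputable def critExp (N : ℕ) (s : ℝ) : ℝ :=
  2 * (N : ℝ) / ((N : ℝ) - 2 * s)

/-- `u` belongs to `X`, the completion of `C_c^∞(ℝ^N)` under `‖·‖_X`, for `N ≥ 3`.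
By the Sobolev inequality a sequence of test functions that is Cauchy for `‖·‖_X` converges in
`L^{2^*}`, its limit determines the class of the sequence in the completion, and the completion is
thereby the space of all `u ∈ L^{2^*}` with finite `‖u‖_X` which are limits, in `‖·‖_X` and in
`L^{2^*}`, of test functions. -/
structure MemX {N : ℕ} (s : ℝ) (u : EuclideanSpace ℝ (Fin N) → ℝ) : Prop where
  memLp : MemLp u (ENNReal.ofReal (critExp N 1)) volume
  xNorm_lt_top : xNorm s u < ⊤
  exists_approx : ∃ φ : ℕ → EuclideanSpace ℝ (Fin N) → ℝ,
    (∀ k, IsTestFunction (φ k)) ∧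
    Tendsto (fun k => xNorm s (fun x => φ k x - u x)) atTop (𝓝 0) ∧
    Tendsto (fun k => eLpNorm (fun x => φ k x - u x) (ENNReal.ofReal (critExp N 1)) volume)
      atTop (𝓝 0)

end MixedSobolev

namespace MixedSobolev

/-! ### Uniform `L^{2^*}` bound on `X` -/

section SobolevBound

variable {N : ℕ}

/-! The gradient enters only through Sobolev's inequality, which bounds `u_n` in `L^{2^*}`;
everything else uses the Gagliardo energy `E`.

The engine is `volume_lt_abs_le_of_half_ball`. If `|u| > t/2` fills at most half of every ball of
radius `R`, a point with `|u| > t` differs by at least `t/2` from half of the ball around it, so its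
energy density is at least of order `t² R^{-2s}`; Markov gives `|{|u| > t}| ≲ E R^{2s} t^{-2}`. It
is used twice.

With `R` adapted to a weak `L^p` bound the hypothesis is automatic, and `p` improves to `2 + (2s/N)
p`. This contraction has fixed point `2_s^*`, so finitely many steps give a weak `L^p` bound with `p
< q`. Hence the small values of `u_n` contribute little to `∫ |u_n|^q`.

With `R` small and fixed, absence of concentration would make `{|u_n| > ε}` small, and Hölder
against `L^{2^*}` would make the large values negligible too. So `|u_n| > ε` on more than half of
some ball of fixed radius (`exists_concentration`); `z_n` is its centre.

Bounded energy and a bound in `L^{2^*}` give compactness in `L^q_loc`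
(`exists_subseq_tendsto_Lp_loc`), and the mass in the ball survives in the limit. -/

theorem HasWeakGradient.add {u v : EuclideanSpace ℝ (Fin N) → ℝ}
    {G H : EuclideanSpace ℝ (Fin N) → EuclideanSpace ℝ (Fin N)}
    (hu : HasWeakGradient u G) (hv : HasWeakGradient v H) :
    HasWeakGradient (fun x => u x + v x) (fun x => G x + H x) := by
  refine ⟨hu.1.add hv.1, hu.2.1.add hv.2.1, fun ψ hψ e => ?_⟩
  have hc : Continuous fun x => fderiv ℝ ψ x e :=
    (hψ.1.continuous_fderiv (by simp)).clm_apply continuous_const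
  have hs : HasCompactSupport fun x => fderiv ℝ ψ x e := hψ.2.fderiv_apply (𝕜 := ℝ) e
  have h1 : ∀ {f : EuclideanSpace ℝ (Fin N) → ℝ}, LocallyIntegrable f volume →
      Integrable (fun x => f x * fderiv ℝ ψ x e) :=
    fun hf => hf.integrable_smul_right_of_hasCompactSupport hc hs
  have h2 : ∀ {F : EuclideanSpace ℝ (Fin N) → EuclideanSpace ℝ (Fin N)},
      LocallyIntegrable F volume → Integrable (fun x => inner ℝ (F x) e * ψ x) := by
    intro F hF
    have := (hF.integrable_smul_left_of_hasCompactSupport hψ.1.continuous hψ.2).inner_const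
      (𝕜 := ℝ) e
    refine this.congr (ae_of_all _ fun x => ?_)
    simp [inner_smul_left, mul_comm]
  simp_rw [add_mul, inner_add_left, add_mul]
  rw [integral_add (h1 hu.1) (h1 hv.1), integral_add (h2 hu.2.1) (h2 hv.2.1), hu.2.2 ψ hψ e,
    hv.2.2 ψ hψ e]
  ring

/-- Integration by parts and the fundamental lemma identify the two gradients in each direction;
finitely many basis directions share one null set. -/
theorem IsTestFunction.norm_fderiv_ae_eq {φ : EuclideanSpace ℝ (Fin N) → ℝ}
    (hφ : IsTestFunction φ) {G : EuclideanSpace ℝ (Fin N) → EuclideanSpace ℝ (Fin N)}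
    (hG : HasWeakGradient φ G) : ∀ᵐ x, ‖fderiv ℝ φ x‖ = ‖G x‖ := by
  have hd : ∀ e, Continuous fun x => fderiv ℝ φ x e := fun e =>
    (hφ.1.continuous_fderiv (by simp)).clm_apply continuous_const
  have key : ∀ e : EuclideanSpace ℝ (Fin N), ∀ᵐ x, inner ℝ (G x) e = fderiv ℝ φ x e := by
    intro e
    refine ae_eq_of_integral_contDiff_smul_eq ?_ (hd e).locallyIntegrable ?_
    · have := hG.2.1
      intro x
      obtain ⟨t, ht, hi⟩ := this x
      exact ⟨t, ht, hi.inner_const (𝕜 := ℝ) e⟩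
    · intro ψ hψ hψc
      have h1 := hG.2.2 ψ ⟨hψ, hψc⟩ e
      have hψd : Continuous fun x => fderiv ℝ ψ x e :=
        (hψ.continuous_fderiv (by simp)).clm_apply continuous_const
      have h2 := integral_mul_fderiv_eq_neg_fderiv_mul_of_integrable (μ := volume)
        (f := φ) (g := ψ) (v := e)
        (((hd e).mul hψ.continuous).integrable_of_hasCompactSupport hψc.mul_left)
        ((hφ.1.continuous.mul hψd).integrable_of_hasCompactSupport hφ.2.mul_right)
        ((hφ.1.continuous.mul hψ.continuous).integrable_of_hasCompactSupport hψc.mul_left)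
        (fun x _ => hφ.1.differentiable (by simp) x)
        (fun x _ => hψ.differentiable (by simp) x)
      simp only [smul_eq_mul]
      simp_rw [mul_comm (ψ _)]
      linarith
  have hall : ∀ᵐ x, ∀ i : Fin N, inner ℝ (G x) (EuclideanSpace.basisFun (Fin N) ℝ i)
      = fderiv ℝ φ x (EuclideanSpace.basisFun (Fin N) ℝ i) := ae_all_iff.2 fun i => key _
  filter_upwards [hall] with x hx
  have : fderiv ℝ φ x = innerSL ℝ (G x) := by
    apply ContinuousLinearMap.coe_injective
    refine (EuclideanSpace.basisFun (Fin N) ℝ).toBasis.ext fun i => ?_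
    simpa using (hx i).symm
  rw [this, innerSL_apply_norm]

theorem two_lt_critExp_one (hN : 3 ≤ N) : 2 < critExp N 1 := by
  have hN' : (3 : ℝ) ≤ N := by exact_mod_cast hN
  unfold critExp
  rw [lt_div_iff₀ (by linarith)]
  linarith

/-- The Sobolev inequality for test functions, in terms of any weak gradient. -/
theorem exists_sobolev_const (hN : 3 ≤ N) : ∃ S : ℝ≥0,
    ∀ (φ : EuclideanSpace ℝ (Fin N) → ℝ)
      (G : EuclideanSpace ℝ (Fin N) → EuclideanSpace ℝ (Fin N)),
      IsTestFunction φ → HasWeakGradient φ G →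
      eLpNorm φ (ENNReal.ofReal (critExp N 1)) volume ≤ S * eLpNorm G 2 volume := by
  refine ⟨SNormLESNormFDerivOfEqConst ℝ
    (volume : Measure (EuclideanSpace ℝ (Fin N))) (2 : ℝ≥0), fun φ G hφ hG => ?_⟩
  have hN' : (3 : ℝ) ≤ N := by exact_mod_cast hN
  have h0 := two_lt_critExp_one hN
  have h := eLpNorm_le_eLpNorm_fderiv_of_eq (volume : Measure (EuclideanSpace ℝ (Fin N)))
    (u := φ) (hφ.1.of_le (by simp)) hφ.2 (p := 2) (p' := (critExp N 1).toNNReal) (by norm_num)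
    (by simp; omega) (by
      rw [Real.coe_toNNReal _ (by linarith)]
      simp only [critExp, finrank_euclideanSpace, Fintype.card_fin]
      have : (N : ℝ) - 2 ≠ 0 := by linarith
      have : (N : ℝ) ≠ 0 := by linarith
      push_cast
      field_simp)
  have h2 : eLpNorm (fderiv ℝ φ) ((2 : ℝ≥0) : ℝ≥0∞) volume = eLpNorm G 2 volume :=
    eLpNorm_congr_norm_ae (hφ.norm_fderiv_ae_eq hG)
  rw [h2] at h
  exact h

theorem energies_le_of_xNorm_le {s : ℝ} {u : EuclideanSpace ℝ (Fin N) → ℝ} {C : ℝ≥0∞}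
    (h : xNorm s u ≤ C) : dirichletEnergy u ≤ C ^ 2 ∧ gagliardoEnergy s u ≤ C ^ 2 := by
  have h1 : dirichletEnergy u + gagliardoEnergy s u ≤ C ^ 2 := by
    have := ENNReal.rpow_le_rpow h (z := 2) (by norm_num)
    rw [xNorm, ← ENNReal.rpow_mul] at this
    simpa using this
  exact ⟨le_self_add.trans h1, le_add_self.trans h1⟩

/-- The strict inequality avoids having to show that the infimum is attained. -/
theorem exists_weakGradient_of_dirichletEnergy_lt {u : EuclideanSpace ℝ (Fin N) → ℝ}
    {C : ℝ≥0∞} (h : dirichletEnergy u < C ^ 2) :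
    ∃ G, HasWeakGradient u G ∧ eLpNorm G 2 volume ≤ C := by
  simp only [dirichletEnergy, iInf_lt_iff] at h
  obtain ⟨G, hG, hlt⟩ := h
  refine ⟨G, hG, ?_⟩
  rw [eLpNorm_eq_lintegral_rpow_enorm_toReal (by simp) (by simp)]
  have := ENNReal.rpow_le_rpow hlt.le (z := 1 / 2) (by norm_num)
  rw [← ENNReal.rpow_natCast C, ← ENNReal.rpow_mul] at this
  simpa using this

/-- A single test function `φ` near `u` suffices: its weak gradient is that of `u` plus that of `φ -
u`, so Sobolev applies to `φ`, and the `L^{2^*}` error is at most 1. -/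
theorem MemX.eLpNorm_le (hN : 3 ≤ N) {s : ℝ} (C : ℝ≥0) : ∃ A : ℝ≥0,
    ∀ u : EuclideanSpace ℝ (Fin N) → ℝ, MemX s u → xNorm s u ≤ C →
      eLpNorm u (ENNReal.ofReal (critExp N 1)) volume ≤ A := by
  obtain ⟨S, hS⟩ := exists_sobolev_const hN
  refine ⟨S * (C + 1 + 1) + 1, fun u hu hC => ?_⟩
  have h1p : (1 : ℝ≥0∞) ≤ ENNReal.ofReal (critExp N 1) := by
    rw [ENNReal.one_le_ofReal]
    linarith [two_lt_critExp_one hN]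
  obtain ⟨φ, hφ, hx, hl⟩ := hu.exists_approx
  obtain ⟨k, hk1, hk2⟩ := ((hx.eventually_lt_const (u := 2⁻¹) (by simp)).and
    (hl.eventually_lt_const (u := 1) (by simp))).exists
  have hCu : dirichletEnergy u < ((C + 1 : ℝ≥0) : ℝ≥0∞) ^ 2 :=
    (energies_le_of_xNorm_le hC).1.trans_lt (by
      norm_cast
      exact pow_lt_pow_left₀ (by simp) (by simp) (by simp))
  obtain ⟨G, hG, hGn⟩ := exists_weakGradient_of_dirichletEnergy_lt hCu
  have hCd : dirichletEnergy (fun x => φ k x - u x) < ((1 : ℝ≥0) : ℝ≥0∞) ^ 2 :=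
    (energies_le_of_xNorm_le hk1.le).1.trans_lt (by
      simp only [ENNReal.coe_one]
      exact ENNReal.pow_lt_pow_left (by simp) (by simp))
  obtain ⟨H, hH, hHn⟩ := exists_weakGradient_of_dirichletEnergy_lt hCd
  have hGH : HasWeakGradient (φ k) (fun x => G x + H x) := by
    have := hG.add hH
    simpa using this
  have hφm : eLpNorm (φ k) (ENNReal.ofReal (critExp N 1)) volume ≤ S * (C + 1 + 1) := by
    refine (hS _ _ (hφ k) hGH).trans ?_
    gcongr
    refine (eLpNorm_add_le hG.2.1.aestronglyMeasurable hH.2.1.aestronglyMeasurable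
      (by norm_num)).trans ?_
    push_cast at hGn hHn
    gcongr
  calc eLpNorm u (ENNReal.ofReal (critExp N 1)) volume
      = eLpNorm (φ k - (fun x => φ k x - u x)) (ENNReal.ofReal (critExp N 1)) volume := by
        congr 1; ext x; simp
    _ ≤ _ := eLpNorm_sub_le (hφ k).1.continuous.aestronglyMeasurable
        ((hφ k).1.continuous.aestronglyMeasurable.sub hu.memLp.1) h1p
    _ ≤ S * (C + 1 + 1) + 1 := by gcongr
    _ = _ := by push_cast; rfl

end SobolevBound

end MixedSobolev

namespace MixedSobolev

/-! ### Level sets and the bootstrap to weak `L^p` with `p < q` -/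

section LevelSets

variable {N : ℕ}

theorem measurable_gagliardo_integrand {s : ℝ} {u : EuclideanSpace ℝ (Fin N) → ℝ}
    (hu : Measurable u) : Measurable fun p : EuclideanSpace ℝ (Fin N) × EuclideanSpace ℝ (Fin N) =>
      ‖u p.1 - u p.2‖ₑ ^ 2 / ENNReal.ofReal (‖p.1 - p.2‖ ^ ((N : ℝ) + 2 * s)) := by
  fun_prop

/-- Markov's inequality for the Gagliardo energy density. -/
theorem volume_mul_le_gagliardoEnergy {s : ℝ} (hs : 0 < s) {u : EuclideanSpace ℝ (Fin N) → ℝ}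
    (hu : Measurable u) {ρ : ℝ} (hρ : 0 < ρ) {κ : ℝ≥0∞} {S : Set (EuclideanSpace ℝ (Fin N))}
    (h : ∀ x ∈ S, ∃ T ⊆ Metric.ball x ρ, MeasurableSet T ∧ κ ≤ ∫⁻ y in T, ‖u x - u y‖ₑ ^ 2) :
    κ * volume S ≤ ENNReal.ofReal (ρ ^ ((N : ℝ) + 2 * s)) * gagliardoEnergy s u := by
  set b := ENNReal.ofReal (ρ ^ ((N : ℝ) + 2 * s)) with hb
  have hb0 : b ≠ 0 := by simp only [hb, ne_eq, ENNReal.ofReal_eq_zero, not_le]; positivity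
  have hbt : b ≠ ⊤ := ENNReal.ofReal_ne_top
  set g : EuclideanSpace ℝ (Fin N) → ℝ≥0∞ := fun x =>
    ∫⁻ y, ‖u x - u y‖ₑ ^ 2 / ENNReal.ofReal (‖x - y‖ ^ ((N : ℝ) + 2 * s)) with hg
  have hgm : Measurable g := (measurable_gagliardo_integrand hu).lintegral_prod_right'
  -- On `T` the kernel denominator is at most `b`. Markov is applied to the superlevel set of `g`,
  -- so `S` need not be measurable.
  have hS : S ⊆ {x | κ / b ≤ g x} := by
    intro x hx
    obtain ⟨T, hTρ, hT, hκ⟩ := h x hx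
    calc κ / b ≤ (∫⁻ y in T, ‖u x - u y‖ₑ ^ 2) / b := by gcongr
      _ = ∫⁻ y in T, ‖u x - u y‖ₑ ^ 2 / b := by
        simp_rw [div_eq_mul_inv]
        rw [lintegral_mul_const]
        fun_prop
      _ ≤ ∫⁻ y in T, ‖u x - u y‖ₑ ^ 2 / ENNReal.ofReal (‖x - y‖ ^ ((N : ℝ) + 2 * s)) := by
        refine setLIntegral_mono' hT fun y hy => ?_
        have : ‖x - y‖ ≤ ρ := by
          have := hTρ hy
          rw [Metric.mem_ball, dist_comm, dist_eq_norm] at this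
          exact this.le
        rw [hb]
        gcongr
      _ ≤ g x := setLIntegral_le_lintegral _ _
  have h1 : κ / b * volume S ≤ gagliardoEnergy s u :=
    (mul_le_mul_right (measure_mono hS) _).trans (mul_meas_ge_le_lintegral hgm _)
  calc κ * volume S = b * (κ / b * volume S) := by
        rw [← mul_assoc, ENNReal.mul_div_cancel hb0 hbt]
    _ ≤ b * gagliardoEnergy s u := by gcongr

/-- The volume of the unit ball. -/
noncomputable def unitBallVolume (N : ℕ) : ℝ :=
  (volume (Metric.ball (0 : EuclideanSpace ℝ (Fin N)) 1)).toReal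

theorem unitBallVolume_pos : 0 < unitBallVolume N :=
  ENNReal.toReal_pos (Metric.measure_ball_pos _ _ one_pos).ne' measure_ball_lt_top.ne

theorem volume_ball_eq (hN : 0 < N) (x : EuclideanSpace ℝ (Fin N)) {r : ℝ} (hr : 0 ≤ r) :
    volume (Metric.ball x r) = ENNReal.ofReal (unitBallVolume N * r ^ (N : ℝ)) := by
  have : Nonempty (Fin N) := ⟨⟨0, hN⟩⟩
  rw [Measure.addHaar_ball _ _ hr, mul_comm, ENNReal.ofReal_mul unitBallVolume_pos.le,
    unitBallVolume, ENNReal.ofReal_toReal measure_ball_lt_top.ne]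
  simp

theorem ofReal_div_two {a : ℝ} : ENNReal.ofReal a / 2 = ENNReal.ofReal (a / 2) := by
  rw [ENNReal.ofReal_div_of_pos two_pos]
  simp

/-- If `|u| > t / 2` fills at most half of each ball of radius `R`, then the set `|u| > t` is
small. -/
theorem volume_lt_abs_le_of_half_ball (hN : 0 < N) {s : ℝ} (hs : 0 < s)
    {u : EuclideanSpace ℝ (Fin N) → ℝ} (hu : Measurable u) {E : ℝ}
    (hgE : gagliardoEnergy s u ≤ ENNReal.ofReal E) {t R : ℝ} (ht : 0 < t) (hR : 0 < R)
    (h : ∀ x, volume (Metric.ball x R ∩ {y | t / 2 < |u y|}) ≤ volume (Metric.ball x R) / 2) :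
    volume {x | t < |u x|} ≤
      ENNReal.ofReal (8 * E / unitBallVolume N * R ^ (2 * s) * t ^ (-2 : ℝ)) := by
  have hc := unitBallVolume_pos (N := N)
  set c := unitBallVolume N
  -- Squared oscillation `(t/2)²` times half the volume of the ball.
  set k : ℝ := (t / 2) ^ 2 * (c * R ^ (N : ℝ) / 2) with hk
  have hk0 : 0 < k := by positivity
  have hmeas : MeasurableSet {y | t / 2 < |u y|} := measurableSet_lt measurable_const hu.abs
  have h1 := volume_mul_le_gagliardoEnergy hs hu hR (κ := ENNReal.ofReal k)
    (S := {x | t < |u x|}) (fun x hx => by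
      refine ⟨Metric.ball x R \ {y | t / 2 < |u y|}, Set.sdiff_subset,
        Metric.isOpen_ball.measurableSet.diff hmeas, ?_⟩
      have hv : ENNReal.ofReal (c * R ^ (N : ℝ) / 2) ≤
          volume (Metric.ball x R \ {y | t / 2 < |u y|}) := by
        have h2 := measure_inter_add_sdiff (μ := volume) (Metric.ball x R) hmeas
        have h3 := h x
        rw [← ofReal_div_two, ← volume_ball_eq hN x hR.le]
        have h4 : volume (Metric.ball x R) / 2 + volume (Metric.ball x R) / 2 ≤
            volume (Metric.ball x R) / 2 + volume (Metric.ball x R \ {y | t / 2 < |u y|}) := by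
          rw [ENNReal.add_halves]
          exact h2.symm.le.trans (by gcongr)
        exact (ENNReal.add_le_add_iff_left
          (ENNReal.div_ne_top measure_ball_lt_top.ne (by simp))).1 h4
      calc ENNReal.ofReal k
          = ENNReal.ofReal (t / 2) ^ 2 * ENNReal.ofReal (c * R ^ (N : ℝ) / 2) := by
            rw [← ENNReal.ofReal_pow (by positivity), ← ENNReal.ofReal_mul (by positivity)]
        _ ≤ ENNReal.ofReal (t / 2) ^ 2 * volume (Metric.ball x R \ {y | t / 2 < |u y|}) := by
            gcongr
        _ = ∫⁻ y in Metric.ball x R \ {y | t / 2 < |u y|}, ENNReal.ofReal (t / 2) ^ 2 := by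
            simp
        _ ≤ _ := by
            refine setLIntegral_mono' (Metric.isOpen_ball.measurableSet.diff hmeas)
              fun y hy => ?_
            have hy2 : |u y| ≤ t / 2 := not_lt.1 hy.2
            have hx2 : t < |u x| := hx
            gcongr
            rw [Real.enorm_eq_ofReal_abs]
            apply ENNReal.ofReal_le_ofReal
            have := abs_sub_abs_le_abs_sub (u x) (u y)
            linarith)
  have h2 : ENNReal.ofReal k * volume {x | t < |u x|} ≤
      ENNReal.ofReal (R ^ ((N : ℝ) + 2 * s) * E) := by
    rw [ENNReal.ofReal_mul (p := R ^ ((N : ℝ) + 2 * s)) (by positivity)]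
    exact h1.trans (by gcongr)
  have h3 : volume {x | t < |u x|} ≤ ENNReal.ofReal (R ^ ((N : ℝ) + 2 * s) * E / k) := by
    rw [ENNReal.ofReal_div_of_pos hk0, ENNReal.le_div_iff_mul_le (by simp [hk0]) (by simp),
      mul_comm]
    exact h2
  refine h3.trans (ENNReal.ofReal_le_ofReal (le_of_eq ?_))
  rw [hk, Real.rpow_add hR, Real.rpow_neg ht.le, Real.rpow_two]
  have : R ^ (N : ℝ) ≠ 0 := by positivity
  field_simp
  ring

/-- One step of the bootstrap for weak Lebesgue bounds. -/
theorem exists_weak_bound_step (hN : 0 < N) {s : ℝ} (hs : 0 < s) {E : ℝ} (hE : 0 ≤ E) {p M : ℝ}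
    (hM : 0 < M) : ∃ M' : ℝ, 0 < M' ∧ ∀ u : EuclideanSpace ℝ (Fin N) → ℝ, Measurable u →
      gagliardoEnergy s u ≤ ENNReal.ofReal E →
      (∀ t : ℝ, 0 < t → volume {x | t < |u x|} ≤ ENNReal.ofReal (M * t ^ (-p))) →
      ∀ t : ℝ, 0 < t → volume {x | t < |u x|} ≤
        ENNReal.ofReal (M' * t ^ (-(2 + 2 * s / N * p))) := by
  have hc := unitBallVolume_pos (N := N)
  have hN' : (0 : ℝ) < N := by exact_mod_cast hN
  set c := unitBallVolume N
  refine ⟨8 * (E + 1) / c * (2 * M * (1 / 2) ^ (-p) / c) ^ (2 * s / N), by positivity,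
    fun u hu hgE hw t ht => ?_⟩
  -- Chosen so that half the volume of a ball of radius `R` equals the assumed bound for `{|u| >
  -- t/2}`.
  set R : ℝ := (2 * M * (t / 2) ^ (-p) / c) ^ (1 / (N : ℝ)) with hR
  have hR0 : 0 < R := by positivity
  have hRN : R ^ (N : ℝ) = 2 * M * (t / 2) ^ (-p) / c := by
    rw [hR, ← Real.rpow_mul (by positivity), one_div_mul_cancel hN'.ne', Real.rpow_one]
  have hRs : R ^ (2 * s) =
      (2 * M * (1 / 2) ^ (-p) / c) ^ (2 * s / N) * t ^ (-(2 * s / N * p)) := by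
    rw [hR, ← Real.rpow_mul (by positivity)]
    have h1 : 2 * M * (t / 2) ^ (-p) / c = 2 * M * (1 / 2) ^ (-p) / c * t ^ (-p) := by
      rw [div_eq_mul_one_div t 2, Real.mul_rpow ht.le (by norm_num)]
      ring
    rw [h1, Real.mul_rpow (by positivity) (by positivity), ← Real.rpow_mul ht.le]
    congr 2 <;> ring
  refine (volume_lt_abs_le_of_half_ball hN hs hu (E := E + 1)
    (hgE.trans (ENNReal.ofReal_le_ofReal (by linarith))) ht hR0 fun x => ?_).trans
    (ENNReal.ofReal_le_ofReal (le_of_eq ?_))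
  · refine (measure_mono Set.inter_subset_right).trans ((hw (t / 2) (by positivity)).trans ?_)
    rw [volume_ball_eq hN x hR0.le, ofReal_div_two, hRN]
    apply ENNReal.ofReal_le_ofReal
    apply le_of_eq
    change _ = c * _ / 2
    field_simp
  · rw [hRs, neg_add, Real.rpow_add ht]
    ring

/-- Bounds in `L^r` and for the Gagliardo energy give a weak `L^p` bound for some `p < q`, whenever
`q` exceeds the fractional critical exponent. -/
theorem exists_weak_bound_lt (hN : 0 < N) {s : ℝ} (hs : 0 < s) (hsN : 2 * s < N) {r q : ℝ}
    (hr : 0 < r) (hq : critExp N s < q) {E A : ℝ} (hE : 0 ≤ E) (hA : 0 ≤ A) :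
    ∃ p < q, ∃ M : ℝ, 0 < M ∧ ∀ u : EuclideanSpace ℝ (Fin N) → ℝ, Measurable u →
      eLpNorm u (ENNReal.ofReal r) volume ≤ ENNReal.ofReal A →
      gagliardoEnergy s u ≤ ENNReal.ofReal E →
      ∀ t : ℝ, 0 < t → volume {x | t < |u x|} ≤ ENNReal.ofReal (M * t ^ (-p)) := by
  have hN' : (0 : ℝ) < N := by exact_mod_cast hN
  set a : ℝ := 2 * s / N with ha
  have ha0 : 0 < a := by positivity
  have ha1 : a < 1 := by rw [ha, div_lt_one hN']; exact hsN
  -- The bootstrap map `p ↦ 2 + a p` fixes `2_s^*`, so its `k`-th iterate from `r` is `2_s^* + a^k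
  -- (r - 2_s^*)`.
  have hfix : 2 + a * critExp N s = critExp N s := by
    have : (N : ℝ) - 2 * s ≠ 0 := by linarith
    rw [ha, critExp]
    field_simp
    ring
  have hiter : ∀ k : ℕ, ∃ M : ℝ, 0 < M ∧ ∀ u : EuclideanSpace ℝ (Fin N) → ℝ, Measurable u →
      eLpNorm u (ENNReal.ofReal r) volume ≤ ENNReal.ofReal A →
      gagliardoEnergy s u ≤ ENNReal.ofReal E →
      ∀ t : ℝ, 0 < t → volume {x | t < |u x|} ≤
        ENNReal.ofReal (M * t ^ (-(critExp N s + a ^ k * (r - critExp N s)))) := by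
    intro k
    induction k with
    | zero =>
      refine ⟨(A + 1) ^ r, by positivity, fun u hu hA' hE' t ht => ?_⟩
      have hr' : (ENNReal.ofReal r).toReal = r := ENNReal.toReal_ofReal hr.le
      have h1 := mul_meas_ge_le_pow_eLpNorm' (volume : Measure (EuclideanSpace ℝ (Fin N)))
        (p := ENNReal.ofReal r) (by simpa using hr) (by simp) hu.aestronglyMeasurable
        (ENNReal.ofReal t)
      rw [hr', ENNReal.ofReal_rpow_of_pos ht] at h1
      have h2 : eLpNorm u (ENNReal.ofReal r) volume ^ r ≤ ENNReal.ofReal ((A + 1) ^ r) := by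
        rw [← ENNReal.ofReal_rpow_of_pos (by positivity)]
        exact ENNReal.rpow_le_rpow (hA'.trans (ENNReal.ofReal_le_ofReal (by linarith))) hr.le
      have h3 : volume {x | t < |u x|} ≤ volume {x | ENNReal.ofReal t ≤ ‖u x‖ₑ} := by
        refine measure_mono fun x hx => ?_
        have hx' : t < |u x| := hx
        simp only [Set.mem_ofPred_eq, Real.enorm_eq_ofReal_abs]
        exact ENNReal.ofReal_le_ofReal hx'.le
      have htr : 0 < t ^ r := by positivity
      have h4 : (A + 1) ^ r * t ^ (-(critExp N s + a ^ 0 * (r - critExp N s))) =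
          (A + 1) ^ r / t ^ r := by
        rw [pow_zero, one_mul, add_sub_cancel, Real.rpow_neg ht.le]
        rfl
      rw [h4, ENNReal.ofReal_div_of_pos htr, ENNReal.le_div_iff_mul_le (by simp [htr]) (by simp),
        mul_comm]
      exact (mul_le_mul_right h3 _).trans (h1.trans h2)
    | succ k ih =>
      obtain ⟨M, hM, hw⟩ := ih
      obtain ⟨M', hM', hw'⟩ := exists_weak_bound_step hN hs hE
        (p := critExp N s + a ^ k * (r - critExp N s)) hM
      refine ⟨M', hM', fun u hu hA' hE' t ht => ?_⟩
      have := hw' u hu hE' (hw u hu hA' hE') t ht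
      have he : critExp N s + a ^ (k + 1) * (r - critExp N s) =
          2 + 2 * s / N * (critExp N s + a ^ k * (r - critExp N s)) := by
        rw [← ha, mul_add, ← add_assoc, hfix]
        ring
      rw [he]
      exact this
  have hlim : Tendsto (fun k : ℕ => critExp N s + a ^ k * (r - critExp N s)) atTop
      (𝓝 (critExp N s)) := by
    have := ((tendsto_pow_atTop_nhds_zero_of_lt_one ha0.le ha1).mul_const
      (r - critExp N s)).const_add (critExp N s)
    simpa using this
  obtain ⟨k, hk⟩ := (hlim.eventually_lt_const hq).exists
  exact ⟨_, hk, hiter k⟩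

end LevelSets

end MixedSobolev

namespace MixedSobolev

/-! ### Concentration on a ball of fixed radius -/

section Concentration

variable {N : ℕ}

/-- Layer-cake formula for `min |u| ε`: only levels `t < ε` contribute, and `t^{q-p-1}` is
integrable at 0 because `p < q`. -/
theorem lintegral_abs_le_le_of_weak_bound {u : EuclideanSpace ℝ (Fin N) → ℝ} (hu : Measurable u)
    {M p q ε : ℝ} (hM : 0 < M) (hq : 0 < q) (hpq : p < q) (hε : 0 < ε)
    (hw : ∀ t : ℝ, 0 < t → volume {x | t < |u x|} ≤ ENNReal.ofReal (M * t ^ (-p))) :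
    ∫⁻ x in {x | |u x| ≤ ε}, ‖u x‖ₑ ^ q ≤ ENNReal.ofReal (q * M / (q - p) * ε ^ (q - p)) := by
  have hS : MeasurableSet {x | |u x| ≤ ε} := measurableSet_le hu.abs measurable_const
  set f : EuclideanSpace ℝ (Fin N) → ℝ := fun x => min |u x| ε with hf
  have hfm : Measurable f := hu.abs.min measurable_const
  have h1 : ∫⁻ x in {x | |u x| ≤ ε}, ‖u x‖ₑ ^ q ≤ ∫⁻ x, ENNReal.ofReal (f x ^ q) := by
    refine le_trans (setLIntegral_mono' hS fun x hx => ?_) (setLIntegral_le_lintegral _ _)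
    have hx' : |u x| ≤ ε := hx
    have hfx : f x = |u x| := min_eq_left hx'
    rw [hfx, Real.enorm_eq_ofReal_abs, ENNReal.ofReal_rpow_of_nonneg
      (abs_nonneg _) hq.le]
  rw [lintegral_rpow_eq_lintegral_meas_lt_mul volume
    (ae_of_all _ fun x => le_min (abs_nonneg _) hε.le) hfm.aemeasurable hq] at h1
  have h2 : ∫⁻ t in Set.Ioi 0, volume {a | t < f a} * ENNReal.ofReal (t ^ (q - 1)) ≤
      ∫⁻ t in Set.Ioc 0 ε, ENNReal.ofReal (M * t ^ (q - p - 1)) := by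
    rw [← lintegral_indicator measurableSet_Ioi, ← lintegral_indicator measurableSet_Ioc]
    refine lintegral_mono fun t => ?_
    by_cases ht : 0 < t
    · rw [Set.indicator_of_mem (by exact ht)]
      by_cases htε : t ≤ ε
      · rw [Set.indicator_of_mem (by exact ⟨ht, htε⟩)]
        have h3 : volume {a | t < f a} ≤ ENNReal.ofReal (M * t ^ (-p)) :=
          (measure_mono (fun x (hx : t < f x) => (lt_min_iff.1 hx).1)).trans (hw t ht)
        calc _ ≤ ENNReal.ofReal (M * t ^ (-p)) * ENNReal.ofReal (t ^ (q - 1)) := by gcongr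
          _ = _ := by
            rw [← ENNReal.ofReal_mul (by positivity), mul_assoc, ← Real.rpow_add ht]
            ring_nf
      · have : {a | t < f a} = ∅ := by
          refine Set.eq_empty_iff_forall_notMem.2 fun x hx => htε ?_
          exact (lt_min_iff.1 hx).2.le
        simp [this]
    · rw [Set.indicator_of_notMem (by exact ht)]
      simp
  have h3 : ∫⁻ t in Set.Ioc 0 ε, ENNReal.ofReal (M * t ^ (q - p - 1)) =
      ENNReal.ofReal (M / (q - p) * ε ^ (q - p)) := by
    have hi : IntervalIntegrable (fun t : ℝ => M * t ^ (q - p - 1)) volume 0 ε :=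
      (intervalIntegral.intervalIntegrable_rpow' (by linarith)).const_mul M
    rw [intervalIntegrable_iff_integrableOn_Ioc_of_le hε.le] at hi
    rw [← ofReal_integral_eq_lintegral_ofReal hi ?_,
      ← intervalIntegral.integral_of_le hε.le, intervalIntegral.integral_const_mul,
      integral_rpow (Or.inl (by linarith))]
    · rw [sub_add_cancel, Real.zero_rpow (by linarith)]
      congr 1
      ring
    · filter_upwards [ae_restrict_mem measurableSet_Ioc] with t ht
      have := ht.1
      simp only [Pi.zero_apply]
      positivity
  calc _ ≤ _ := h1
    _ ≤ ENNReal.ofReal q * ENNReal.ofReal (M / (q - p) * ε ^ (q - p)) := by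
      rw [← h3]
      gcongr
    _ = _ := by
      rw [← ENNReal.ofReal_mul hq.le]
      congr 1
      ring

/-- A bound in `L^r` gives uniform `q`-integrability for `q < r`. -/
theorem exists_eLpNorm_restrict_le {α : Type*} [MeasurableSpace α] (μ : Measure α) {q r A η : ℝ}
    (hq : 0 < q) (hqr : q < r) (hA : 0 ≤ A) (hη : 0 < η) : ∃ δ : ℝ, 0 < δ ∧
      ∀ (u : α → ℝ) (S : Set α), AEStronglyMeasurable u μ →
        eLpNorm u (ENNReal.ofReal r) μ ≤ ENNReal.ofReal A → μ S ≤ ENNReal.ofReal δ →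
        eLpNorm u (ENNReal.ofReal q) (μ.restrict S) ≤ ENNReal.ofReal η := by
  have hr : 0 < r := hq.trans hqr
  have hθ : 0 < 1 / q - 1 / r := sub_pos.2 (one_div_lt_one_div_of_lt hq hqr)
  have hδ : 0 < (η / (A + 1)) ^ (1 / (1 / q - 1 / r)) := by positivity
  refine ⟨(η / (A + 1)) ^ (1 / (1 / q - 1 / r)), hδ, fun u S hu hA' hS => ?_⟩
  have h := eLpNorm_le_eLpNorm_mul_rpow_measure_univ (μ := μ.restrict S)
    (ENNReal.ofReal_le_ofReal hqr.le) hu.restrict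
  rw [ENNReal.toReal_ofReal hq.le, ENNReal.toReal_ofReal hr.le, Measure.restrict_apply_univ] at h
  calc _ ≤ _ := h
    _ ≤ ENNReal.ofReal (A + 1) *
        ENNReal.ofReal ((η / (A + 1)) ^ (1 / (1 / q - 1 / r))) ^ (1 / q - 1 / r) := by
      gcongr
      exact (eLpNorm_mono_measure _ Measure.restrict_le_self).trans
        (hA'.trans (ENNReal.ofReal_le_ofReal (by linarith)))
    _ = ENNReal.ofReal η := by
      rw [ENNReal.ofReal_rpow_of_pos hδ, ← Real.rpow_mul (by positivity),
        one_div_mul_cancel hθ.ne', Real.rpow_one, ← ENNReal.ofReal_mul (by positivity)]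
      congr 1
      field_simp

theorem lintegral_rpow_eq_eLpNorm_rpow {α : Type*} [MeasurableSpace α] (μ : Measure α) {q : ℝ}
    (hq : 0 < q) (u : α → ℝ) : ∫⁻ x, ‖u x‖ₑ ^ q ∂μ = eLpNorm u (ENNReal.ofReal q) μ ^ q := by
  rw [eLpNorm_eq_lintegral_rpow_enorm_toReal (by simpa using hq) (by simp),
    ENNReal.toReal_ofReal hq.le, ← ENNReal.rpow_mul, one_div_mul_cancel hq.ne', ENNReal.rpow_one]

/-- Functions that are bounded in `L^r` and in Gagliardo energy, with `L^q` norm bounded from below,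
concentrate on some ball of fixed radius. -/
theorem exists_concentration (hN : 0 < N) {s : ℝ} (hs : 0 < s) (hsN : 2 * s < N) {r q : ℝ}
    (hq0 : 0 < q) (hq : critExp N s < q) (hqr : q < r) {E A η : ℝ} (hE : 0 ≤ E) (hA : 0 ≤ A)
    (hη : 0 < η) : ∃ ε R : ℝ, 0 < ε ∧ 0 < R ∧ ∀ u : EuclideanSpace ℝ (Fin N) → ℝ, Measurable u →
      eLpNorm u (ENNReal.ofReal r) volume ≤ ENNReal.ofReal A →
      gagliardoEnergy s u ≤ ENNReal.ofReal E →
      ENNReal.ofReal η ≤ ∫⁻ x, ‖u x‖ₑ ^ q →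
      ∃ z, volume (Metric.ball z R) / 2 < volume (Metric.ball z R ∩ {y | ε < |u y|}) := by
  obtain ⟨p, hpq, M, hM, hw⟩ := exists_weak_bound_lt hN hs hsN (hq0.trans hqr) hq hE hA
  have hη3 : 0 < η / 3 := by positivity
  have hqp : 0 < q - p := sub_pos.2 hpq
  obtain ⟨ε, hεη, hε⟩ : ∃ ε : ℝ, q * M / (q - p) * ε ^ (q - p) < η / 3 ∧ 0 < ε := by
    have h1 : Tendsto (fun ε : ℝ => q * M / (q - p) * ε ^ (q - p)) (𝓝[>] 0) (𝓝 0) := by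
      have := ((Real.continuousAt_rpow_const 0 (q - p) (Or.inr hqp.le)).tendsto.const_mul
        (q * M / (q - p))).mono_left (nhdsWithin_le_nhds (s := Set.Ioi 0))
      simpa [Real.zero_rpow hqp.ne'] using this
    exact ((h1.eventually_lt_const hη3).and self_mem_nhdsWithin).exists
  obtain ⟨δ, hδ, hδS⟩ := exists_eLpNorm_restrict_le
    (volume : Measure (EuclideanSpace ℝ (Fin N))) hq0 hqr hA
    (η := (η / 3) ^ (1 / q)) (by positivity)
  obtain ⟨R, hRδ, hR⟩ : ∃ R : ℝ,
      8 * E / unitBallVolume N * R ^ (2 * s) * ε ^ (-2 : ℝ) < δ ∧ 0 < R := by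
    have h1 : Tendsto (fun R : ℝ => 8 * E / unitBallVolume N * R ^ (2 * s) * ε ^ (-2 : ℝ))
        (𝓝[>] 0) (𝓝 0) := by
      have := (((Real.continuousAt_rpow_const 0 (2 * s) (Or.inr (by positivity))).tendsto.const_mul
        (8 * E / unitBallVolume N)).mul_const (ε ^ (-2 : ℝ))).mono_left
        (nhdsWithin_le_nhds (s := Set.Ioi 0))
      have h2s : 2 * s ≠ 0 := by positivity
      simpa [Real.zero_rpow h2s] using this
    exact ((h1.eventually_lt_const hδ).and self_mem_nhdsWithin).exists
  -- The half-ball lemma at level `ε` has its hypothesis at level `ε / 2`. Without concentration,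
  -- small and large values each contribute at most `η / 3`, too little to reach `η`.
  refine ⟨ε / 2, R, by positivity, hR, fun u hu hA' hE' hlow => ?_⟩
  by_contra! hcon
  have hvol := (volume_lt_abs_le_of_half_ball hN hs hu hE' hε hR hcon).trans
    (ENNReal.ofReal_le_ofReal hRδ.le)
  have h1 := lintegral_abs_le_le_of_weak_bound hu hM hq0 hpq hε (hw u hu hA' hE')
  have h2 : ∫⁻ x in {x | ε < |u x|}, ‖u x‖ₑ ^ q ≤ ENNReal.ofReal (η / 3) := by
    rw [lintegral_rpow_eq_eLpNorm_rpow _ hq0]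
    calc _ ≤ ENNReal.ofReal ((η / 3) ^ (1 / q)) ^ q := by
          gcongr
          exact hδS u _ hu.aestronglyMeasurable hA' hvol
      _ = _ := by
          rw [ENNReal.ofReal_rpow_of_pos (by positivity), ← Real.rpow_mul hη3.le,
            one_div_mul_cancel hq0.ne', Real.rpow_one]
  have hS : MeasurableSet {x | |u x| ≤ ε} := measurableSet_le hu.abs measurable_const
  have hSc : {x | |u x| ≤ ε}ᶜ = {x | ε < |u x|} := by ext; simp
  rw [← lintegral_add_compl _ hS, hSc] at hlow
  have h3 : ENNReal.ofReal η ≤ ENNReal.ofReal (η / 3 + η / 3) := by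
    rw [ENNReal.ofReal_add hη3.le hη3.le]
    exact hlow.trans (add_le_add (h1.trans (ENNReal.ofReal_le_ofReal hεη.le)) h2)
  rw [ENNReal.ofReal_le_ofReal_iff (by positivity)] at h3
  linarith

end Concentration

end MixedSobolev

namespace MixedSobolev

/-! ### Local compactness from the Gagliardo energy -/

section Compactness

variable {N : ℕ}

theorem gagliardoEnergy_sub_le {s : ℝ} {u v : EuclideanSpace ℝ (Fin N) → ℝ} (hu : Measurable u)
    (hv : Measurable v) : gagliardoEnergy s (fun x => u x - v x) ≤
      2 * gagliardoEnergy s u + 2 * gagliardoEnergy s v := by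
  have hmu := measurable_gagliardo_integrand (s := s) hu
  have hmv := measurable_gagliardo_integrand (s := s) hv
  unfold gagliardoEnergy
  rw [← lintegral_const_mul _ hmu.lintegral_prod_right',
    ← lintegral_const_mul _ hmv.lintegral_prod_right',
    ← lintegral_add_left (hmu.lintegral_prod_right'.const_mul _)]
  refine lintegral_mono fun x => ?_
  have hxu := hmu.comp (measurable_prodMk_left (x := x))
  have hxv := hmv.comp (measurable_prodMk_left (x := x))
  simp only [Function.comp_def] at hxu hxv
  dsimp only
  rw [← lintegral_const_mul _ hxu, ← lintegral_const_mul _ hxv,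
    ← lintegral_add_left (hxu.const_mul _)]
  refine lintegral_mono fun y => ?_
  dsimp only
  rw [← mul_div_assoc, ← mul_div_assoc, ← ENNReal.add_div]
  gcongr
  have h2 : (2 : ℝ≥0∞) = ENNReal.ofReal 2 := by simp
  simp only [Real.enorm_eq_ofReal_abs]
  rw [h2, ← ENNReal.ofReal_pow (abs_nonneg _), ← ENNReal.ofReal_pow (abs_nonneg _),
    ← ENNReal.ofReal_pow (abs_nonneg _), ← ENNReal.ofReal_mul two_pos.le,
    ← ENNReal.ofReal_mul two_pos.le, ← ENNReal.ofReal_add (by positivity) (by positivity)]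
  apply ENNReal.ofReal_le_ofReal
  simp only [sq_abs]
  nlinarith [sq_nonneg ((u x - u y) + (v x - v y))]

theorem sq_lintegral_enorm_le {α : Type*} [MeasurableSpace α] {μ : Measure α} {g : α → ℝ}
    (hg : AEStronglyMeasurable g μ) :
    (∫⁻ x, ‖g x‖ₑ ∂μ) ^ 2 ≤ μ Set.univ * ∫⁻ x, ‖g x‖ₑ ^ 2 ∂μ := by
  have h := eLpNorm_le_eLpNorm_mul_rpow_measure_univ (p := 1) (q := 2) (by norm_num) hg
  have h2 := lintegral_rpow_eq_eLpNorm_rpow μ two_pos g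
  simp only [ENNReal.rpow_two, ENNReal.ofReal_ofNat] at h2
  rw [eLpNorm_one_eq_lintegral_enorm] at h
  calc _ ≤ (eLpNorm g 2 μ * μ Set.univ ^ (1 / ENNReal.toReal 1 - 1 / ENNReal.toReal 2)) ^ 2 := by
        gcongr
    _ = _ := by
        rw [mul_pow, ← h2, mul_comm, ← ENNReal.rpow_natCast, ← ENNReal.rpow_mul]
        norm_num

/-- Hölder confines each integral to a bounded interval; sequential compactness of the countable
product yields one subsequence for all sets. -/
theorem exists_subseq_tendsto_setIntegral {α ι : Type*} [MeasurableSpace α] {μ : Measure α}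
    [Countable ι] {B : ι → Set α} (hB : ∀ i, μ (B i) ≠ ⊤) {r A : ℝ} (hr : 1 ≤ r)
    {v : ℕ → α → ℝ} (hv : ∀ n, AEStronglyMeasurable (v n) μ)
    (hA : ∀ n, eLpNorm (v n) (ENNReal.ofReal r) μ ≤ ENNReal.ofReal A) :
    ∃ j : ℕ → ℕ, StrictMono j ∧
      ∀ i, ∃ a : ℝ, Tendsto (fun n => ∫ x in B i, v (j n) x ∂μ) atTop (𝓝 a) := by
  set C : ι → ℝ≥0∞ := fun i => ENNReal.ofReal A * μ (B i) ^ (1 - 1 / r) with hC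
  have hCt : ∀ i, C i ≠ ⊤ := fun i => ENNReal.mul_ne_top (by simp)
    (ENNReal.rpow_ne_top_of_nonneg (sub_nonneg.2 (by rw [div_le_one] <;> linarith)) (hB i))
  have hbound : ∀ n i, |∫ x in B i, v n x ∂μ| ≤ (C i).toReal := by
    intro n i
    rw [← Real.norm_eq_abs]
    refine (norm_integral_le_lintegral_norm _).trans (ENNReal.toReal_mono (hCt i) ?_)
    simp_rw [ofReal_norm]
    have h := eLpNorm_le_eLpNorm_mul_rpow_measure_univ (p := 1) (q := ENNReal.ofReal r)
      (by simpa using hr) (hv n).restrict (μ := μ.restrict (B i))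
    rw [eLpNorm_one_eq_lintegral_enorm, ENNReal.toReal_ofReal (by linarith),
      Measure.restrict_apply_univ, ENNReal.toReal_one, div_one] at h
    refine h.trans ?_
    simp only [hC]
    gcongr
    exact (eLpNorm_mono_measure _ Measure.restrict_le_self).trans (hA n)
  have hcpt : IsCompact (Set.univ.pi fun i => Set.Icc (-(C i).toReal) (C i).toReal) :=
    isCompact_univ_pi fun i => isCompact_Icc
  obtain ⟨a, -, j, hj, hlim⟩ := hcpt.tendsto_subseq
    (x := fun n i => ∫ x in B i, v n x ∂μ) fun n i _ => abs_le.1 (hbound n i)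
  exact ⟨j, hj, fun i => ⟨a i, (tendsto_pi_nhds.1 hlim) i⟩⟩

/-- Functions of bounded Gagliardo energy whose averages over small balls of a countable family
converge form a Cauchy sequence in measure on compact sets. -/
theorem eventually_volume_inter_le_of_tendsto_setIntegral (hN : 0 < N) {s : ℝ} (hs : 0 < s)
    {E : ℝ} {v : ℕ → EuclideanSpace ℝ (Fin N) → ℝ} (hv : ∀ n, Measurable (v n))
    (hvi : ∀ n, LocallyIntegrable (v n) volume)
    (hgE : ∀ n, gagliardoEnergy s (v n) ≤ ENNReal.ofReal E)
    {d : ℕ → EuclideanSpace ℝ (Fin N)} (hd : DenseRange d)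
    (hlim : ∀ k m : ℕ, ∃ a : ℝ, Tendsto
      (fun n => ∫ x in Metric.ball (d k) (1 / ((m : ℝ) + 1)), v n x) atTop (𝓝 a))
    {K : Set (EuclideanSpace ℝ (Fin N))} (hK : IsCompact K) {δ η : ℝ} (hδ : 0 < δ) (hη : 0 < η) :
    ∃ n₀, ∀ a ≥ n₀, ∀ b ≥ n₀,
      volume (K ∩ {x | δ < |v a x - v b x|}) ≤ ENNReal.ofReal η := by
  have hc := unitBallVolume_pos (N := N)
  set c := unitBallVolume N
  -- This is `(2ρ)^{N+2s} · 4E / ((δ/2)² c ρ^N)`, the final Markov bound, with `ρ = 1/(m+1)`.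
  obtain ⟨m, hm⟩ : ∃ m : ℕ, 16 * 2 ^ ((N : ℝ) + 2 * s) * E / (c * δ ^ 2) *
      (1 / ((m : ℝ) + 1)) ^ (2 * s) < η := by
    have h2s : 2 * s ≠ 0 := by positivity
    have h1 := (((Real.continuousAt_rpow_const 0 (2 * s) (Or.inr (by positivity))).tendsto.comp
      (tendsto_one_div_add_atTop_nhds_zero_nat (𝕜 := ℝ))).const_mul
      (16 * 2 ^ ((N : ℝ) + 2 * s) * E / (c * δ ^ 2)))
    rw [Real.zero_rpow h2s, mul_zero] at h1
    exact (h1.eventually_lt_const hη).exists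
  set ρ : ℝ := 1 / ((m : ℝ) + 1)
  have hρ : 0 < ρ := by positivity
  have hb0 : 0 < c * ρ ^ (N : ℝ) := by positivity
  obtain ⟨F, hF⟩ := hK.elim_finite_subcover (fun k => Metric.ball (d k) ρ)
    (fun k => Metric.isOpen_ball) fun x _ => by
      obtain ⟨k, hk⟩ := hd.exists_dist_lt x hρ
      exact Set.mem_iUnion.2 ⟨k, hk⟩
  -- Averages of `f = v a - v b` are thus below `δ/2`. Where `|f x| > δ`, the mean of `f x - f y`
  -- over the ball exceeds `δ/2` in size, and Cauchy–Schwarz bounds its mean square below.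
  have hcau : ∀ k ∈ F, ∃ n₀, ∀ a ≥ n₀, ∀ b ≥ n₀,
      |(∫ x in Metric.ball (d k) ρ, v a x) - ∫ x in Metric.ball (d k) ρ, v b x| <
        δ / 2 * (c * ρ ^ (N : ℝ)) := by
    intro k _
    obtain ⟨l, hl⟩ := hlim k m
    obtain ⟨n₀, hn₀⟩ := Metric.cauchySeq_iff.1 hl.cauchySeq (δ / 2 * (c * ρ ^ (N : ℝ)))
      (by positivity)
    exact ⟨n₀, fun a ha b hb => by
      rw [← Real.dist_eq]
      exact hn₀ a ha b hb⟩
  choose! n₁ hn₁ using hcau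
  refine ⟨F.sup n₁, fun a ha b hb => ?_⟩
  have hf : Measurable fun x => v a x - v b x := (hv a).sub (hv b)
  have hfE : gagliardoEnergy s (fun x => v a x - v b x) ≤ ENNReal.ofReal (4 * E) := by
    refine (gagliardoEnergy_sub_le (hv a) (hv b)).trans ?_
    calc _ ≤ 2 * ENNReal.ofReal E + 2 * ENNReal.ofReal E := by
          gcongr
          · exact hgE a
          · exact hgE b
      _ = _ := by
          rw [ENNReal.ofReal_mul (by norm_num), ← add_mul]
          norm_num
  have hκ : 0 < (δ / 2) ^ 2 * (c * ρ ^ (N : ℝ)) := by positivity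
  -- A ball of radius `ρ` containing `x` lies within distance `2ρ` of `x`.
  have h1 := volume_mul_le_gagliardoEnergy hs hf (ρ := 2 * ρ) (by positivity)
    (κ := ENNReal.ofReal ((δ / 2) ^ 2 * (c * ρ ^ (N : ℝ))))
    (S := K ∩ {x | δ < |v a x - v b x|}) (fun x hx => by
      obtain ⟨k, hkF, hxk⟩ := Set.mem_iUnion₂.1 (hF hx.1)
      have hxk' : dist x (d k) < ρ := hxk
      refine ⟨Metric.ball (d k) ρ, Metric.ball_subset_ball' (by
        rw [dist_comm]; linarith), Metric.isOpen_ball.measurableSet, ?_⟩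
      have hvol : volume (Metric.ball (d k) ρ) = ENNReal.ofReal (c * ρ ^ (N : ℝ)) :=
        volume_ball_eq hN _ hρ.le
      have hreal : (volume : Measure (EuclideanSpace ℝ (Fin N))).real (Metric.ball (d k) ρ) =
          c * ρ ^ (N : ℝ) := by
        rw [Measure.real, hvol, ENNReal.toReal_ofReal hb0.le]
      have hint : ∀ n, IntegrableOn (v n) (Metric.ball (d k) ρ) volume := fun n =>
        ((hvi n).integrableOn_isCompact (isCompact_closedBall (d k) ρ)).mono_set
          Metric.ball_subset_closedBall
      have hdx : δ < |v a x - v b x| := hx.2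
      have hsmall := hn₁ k hkF a ((Finset.le_sup hkF).trans ha) b ((Finset.le_sup hkF).trans hb)
      have hI : ∫ y in Metric.ball (d k) ρ, ((v a x - v b x) - (v a y - v b y)) =
          (v a x - v b x) * (c * ρ ^ (N : ℝ)) - ((∫ x in Metric.ball (d k) ρ, v a x) -
            ∫ x in Metric.ball (d k) ρ, v b x) := by
        have hcst : IntegrableOn (fun _ => v a x - v b x) (Metric.ball (d k) ρ) volume :=
          integrableOn_const measure_ball_lt_top.ne
        have hab : IntegrableOn (fun y => v a y - v b y) (Metric.ball (d k) ρ) volume :=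
          (hint a).sub (hint b)
        rw [integral_sub hcst hab, integral_sub (hint a) (hint b), setIntegral_const, hreal, smul_eq_mul, mul_comm]
      have hIlow : δ / 2 * (c * ρ ^ (N : ℝ)) ≤
          |∫ y in Metric.ball (d k) ρ, ((v a x - v b x) - (v a y - v b y))| := by
        rw [hI]
        refine le_trans ?_ (abs_sub_abs_le_abs_sub _ _)
        rw [abs_mul, abs_of_pos hb0]
        nlinarith
      have hL1 : ENNReal.ofReal (δ / 2 * (c * ρ ^ (N : ℝ))) ≤
          ∫⁻ y in Metric.ball (d k) ρ, ‖(v a x - v b x) - (v a y - v b y)‖ₑ := by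
        refine (ENNReal.ofReal_le_ofReal hIlow).trans ?_
        rw [← Real.enorm_eq_ofReal_abs]
        exact enorm_integral_le_lintegral_enorm _
      have hCS := sq_lintegral_enorm_le
        (μ := volume.restrict (Metric.ball (d k) ρ))
        (g := fun y => (v a x - v b x) - (v a y - v b y))
        (measurable_const.sub hf).aestronglyMeasurable
      rw [Measure.restrict_apply_univ, hvol] at hCS
      rw [← ENNReal.mul_le_mul_iff_right (a := ENNReal.ofReal (c * ρ ^ (N : ℝ)))
        (ENNReal.ofReal_pos.2 hb0).ne' (by simp)]
      refine le_trans ?_ hCS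
      refine le_trans (le_of_eq ?_) (pow_le_pow_left₀ zero_le hL1 2)
      rw [← ENNReal.ofReal_pow (by positivity), ← ENNReal.ofReal_mul (by positivity)]
      congr 1
      ring)
  have h2 : volume (K ∩ {x | δ < |v a x - v b x|}) ≤
      ENNReal.ofReal ((2 * ρ) ^ ((N : ℝ) + 2 * s) * (4 * E) /
        ((δ / 2) ^ 2 * (c * ρ ^ (N : ℝ)))) := by
    rw [ENNReal.ofReal_div_of_pos hκ, ENNReal.le_div_iff_mul_le (Or.inl (ENNReal.ofReal_pos.2 hκ).ne')
      (by simp),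
      mul_comm, ENNReal.ofReal_mul (p := (2 * ρ) ^ ((N : ℝ) + 2 * s)) (by positivity)]
    exact h1.trans (by gcongr)
  refine h2.trans (ENNReal.ofReal_le_ofReal (le_trans (le_of_eq ?_) hm.le))
  rw [Real.mul_rpow two_pos.le hρ.le, Real.rpow_add hρ]
  have : ρ ^ (N : ℝ) ≠ 0 := by positivity
  field_simp
  ring

/-- Riesz's argument: consecutive differences exceed `2^{-n}` on the ball of radius `n` only on sets
of summable measure, so Borel–Cantelli applies. The growing balls exhaust the space. -/
theorem exists_subseq_tendsto_ae_of_cauchy_in_measure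
    {v : ℕ → EuclideanSpace ℝ (Fin N) → ℝ} (hv : ∀ n, Measurable (v n))
    (h : ∀ K : Set (EuclideanSpace ℝ (Fin N)), IsCompact K → ∀ δ η : ℝ, 0 < δ → 0 < η →
      ∃ n₀, ∀ a ≥ n₀, ∀ b ≥ n₀, volume (K ∩ {x | δ < |v a x - v b x|}) ≤ ENNReal.ofReal η) :
    ∃ (j : ℕ → ℕ) (w : EuclideanSpace ℝ (Fin N) → ℝ), StrictMono j ∧ Measurable w ∧
      ∀ᵐ x, Tendsto (fun n => v (j n) x) atTop (𝓝 (w x)) := by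
  have hpos : ∀ n : ℕ, (0 : ℝ) < (1 / 2) ^ n := fun n => by positivity
  choose n₀ hn₀ using fun n : ℕ => h (Metric.closedBall 0 n) (isCompact_closedBall 0 (n : ℝ))
    ((1 / 2) ^ n) ((1 / 2) ^ n) (hpos n) (hpos n)
  obtain ⟨j, hj, hjn⟩ := Filter.extraction_forall_of_eventually
    (P := fun n k => n₀ n ≤ k) fun n => eventually_ge_atTop (n₀ n)
  have hsum : ∑' n : ℕ, volume (Metric.closedBall (0 : EuclideanSpace ℝ (Fin N)) n ∩
      {x | (1 / 2 : ℝ) ^ n < |v (j n) x - v (j (n + 1)) x|}) ≠ ⊤ := by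
    refine ne_top_of_le_ne_top ?_ (ENNReal.tsum_le_tsum fun n => hn₀ n (j n) (hjn n) (j (n + 1))
      ((hjn n).trans (hj.monotone n.le_succ)))
    rw [← ENNReal.ofReal_tsum_of_nonneg (fun n => (hpos n).le) summable_geometric_two]
    exact ENNReal.ofReal_ne_top
  have hconv : ∀ᵐ x, ∃ l, Tendsto (fun n => v (j n) x) atTop (𝓝 l) := by
    filter_upwards [ae_eventually_notMem hsum] with x hx
    refine cauchySeq_tendsto_of_complete (cauchySeq_of_summable_dist ?_)
    refine Summable.of_norm_bounded_eventually_nat summable_geometric_two ?_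
    filter_upwards [hx, eventually_ge_atTop ⌈‖x‖⌉₊] with n hn hnx
    rw [Real.norm_of_nonneg dist_nonneg, Real.dist_eq]
    by_contra hlt
    exact hn ⟨by simpa using Nat.ceil_le.1 hnx, not_le.1 hlt⟩
  obtain ⟨w, hw, hlim⟩ := measurable_limit_of_tendsto_metrizable_ae
    (fun n => (hv (j n)).aemeasurable) hconv
  exact ⟨j, w, hj, hw, hlim⟩

/-- Vitali's theorem: the `L^r` bound with `q < r` gives uniform integrability, and Fatou passes the
bound to `w`. -/
theorem tendsto_eLpNorm_restrict_of_tendsto_ae {α : Type*} [MeasurableSpace α] {μ : Measure α}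
    {q r A : ℝ} (hq : 1 ≤ q) (hqr : q < r) (hA : 0 ≤ A) {v : ℕ → α → ℝ} {w : α → ℝ}
    (hv : ∀ n, Measurable (v n)) (hw : Measurable w)
    (hvA : ∀ n, eLpNorm (v n) (ENNReal.ofReal r) μ ≤ ENNReal.ofReal A)
    (hlim : ∀ᵐ x ∂μ, Tendsto (fun n => v n x) atTop (𝓝 (w x))) {K : Set α} (hK : μ K ≠ ⊤) :
    MemLp w (ENNReal.ofReal q) (μ.restrict K) ∧
      Tendsto (fun n => eLpNorm (fun x => v n x - w x) (ENNReal.ofReal q) (μ.restrict K))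
        atTop (𝓝 0) := by
  have : IsFiniteMeasure (μ.restrict K) := ⟨by simpa using hK.lt_top⟩
  have hwA : eLpNorm w (ENNReal.ofReal r) μ ≤ ENNReal.ofReal A := by
    refine (Lp.eLpNorm_lim_le_liminf_eLpNorm (fun n => (hv n).aestronglyMeasurable) w hlim).trans ?_
    exact liminf_le_of_frequently_le' (Frequently.of_forall hvA)
  have hwr : MemLp w (ENNReal.ofReal r) μ :=
    ⟨hw.aestronglyMeasurable, hwA.trans_lt ENNReal.ofReal_lt_top⟩
  have hwq : MemLp w (ENNReal.ofReal q) (μ.restrict K) :=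
    (hwr.restrict K).mono_exponent (ENNReal.ofReal_le_ofReal hqr.le)
  refine ⟨hwq, tendsto_Lp_finite_of_tendsto_ae (by simpa using hq) (by simp)
    (fun n => (hv n).aestronglyMeasurable) hwq ?_ (ae_restrict_of_ae hlim)⟩
  intro η hη
  obtain ⟨δ, hδ, h⟩ := exists_eLpNorm_restrict_le (μ.restrict K) (by linarith : 0 < q) hqr hA hη
  refine ⟨δ, hδ, fun n S hS hSδ => ?_⟩
  rw [eLpNorm_indicator_eq_eLpNorm_restrict hS]
  exact h _ _ (hv n).aestronglyMeasurable
    ((eLpNorm_mono_measure _ Measure.restrict_le_self).trans (hvA n)) hSδ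

/-- Local compactness: a sequence that is bounded in `L^r` and in Gagliardo energy has a subsequence
converging in `L^q_loc` for all `1 ≤ q < r`. -/
theorem exists_subseq_tendsto_Lp_loc (hN : 0 < N) {s : ℝ} (hs : 0 < s) {q r E A : ℝ}
    (hq : 1 ≤ q) (hqr : q < r) (hA : 0 ≤ A)
    {v : ℕ → EuclideanSpace ℝ (Fin N) → ℝ} (hv : ∀ n, Measurable (v n))
    (hvA : ∀ n, eLpNorm (v n) (ENNReal.ofReal r) volume ≤ ENNReal.ofReal A)
    (hgE : ∀ n, gagliardoEnergy s (v n) ≤ ENNReal.ofReal E) :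
    ∃ (j : ℕ → ℕ) (w : EuclideanSpace ℝ (Fin N) → ℝ), StrictMono j ∧
      ∀ K : Set (EuclideanSpace ℝ (Fin N)), IsCompact K →
        MemLp w (ENNReal.ofReal q) (volume.restrict K) ∧
        Tendsto (fun k => eLpNorm (fun x => v (j k) x - w x) (ENNReal.ofReal q)
          (volume.restrict K)) atTop (𝓝 0) := by
  have hr : 1 ≤ r := hq.trans hqr.le
  obtain ⟨j₁, hj₁, hlim⟩ := exists_subseq_tendsto_setIntegral
    (B := fun i : ℕ × ℕ => Metric.ball
      (TopologicalSpace.denseSeq (EuclideanSpace ℝ (Fin N)) i.1) (1 / ((i.2 : ℝ) + 1)))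
    (fun i => measure_ball_lt_top.ne) hr (fun n => (hv n).aestronglyMeasurable) hvA
  have hloc : ∀ n, LocallyIntegrable (v n) volume := fun n =>
    (show MemLp (v n) (ENNReal.ofReal r) volume from
      ⟨(hv n).aestronglyMeasurable, (hvA n).trans_lt ENNReal.ofReal_lt_top⟩).locallyIntegrable
      (by simpa using hr)
  obtain ⟨j₂, w, hj₂, hw, hae⟩ := exists_subseq_tendsto_ae_of_cauchy_in_measure
    (v := fun n => v (j₁ n)) (fun n => hv _) fun K hK δ η hδ hη =>
      eventually_volume_inter_le_of_tendsto_setIntegral hN hs (fun n => hv _)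
        (fun n => hloc _) (fun n => hgE _) (TopologicalSpace.denseRange_denseSeq _)
        (fun k m => hlim (k, m)) hK hδ hη
  exact ⟨j₁ ∘ j₂, w, hj₁.comp hj₂, fun K hK =>
    tendsto_eLpNorm_restrict_of_tendsto_ae hq hqr hA (fun n => hv _) hw (fun n => hvA _) hae
      hK.measure_lt_top.ne⟩

end Compactness

end MixedSobolev

namespace MixedSobolev

/-! ### Invariance of the energy -/

section Translates

variable {N : ℕ}

theorem gagliardoEnergy_congr_ae {s : ℝ} {u v : EuclideanSpace ℝ (Fin N) → ℝ}
    (h : u =ᵐ[volume] v) : gagliardoEnergy s u = gagliardoEnergy s v := by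
  refine lintegral_congr_ae ?_
  filter_upwards [h] with x hx
  refine lintegral_congr_ae ?_
  filter_upwards [h] with y hy
  rw [hx, hy]

theorem gagliardoEnergy_translate {s : ℝ} (u : EuclideanSpace ℝ (Fin N) → ℝ)
    (z : EuclideanSpace ℝ (Fin N)) :
    gagliardoEnergy s (fun x => u (x + z)) = gagliardoEnergy s u := by
  unfold gagliardoEnergy
  symm
  rw [← lintegral_add_right_eq_self _ z]
  refine lintegral_congr fun x => ?_
  rw [← lintegral_add_right_eq_self (fun y => ‖u (x + z) - u y‖ₑ ^ 2 /
    ENNReal.ofReal (‖x + z - y‖ ^ ((N : ℝ) + 2 * s))) z]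
  simp only [add_sub_add_right_eq_sub]

theorem two_le_critExp {s : ℝ} (hs : 0 ≤ s) (hsN : 2 * s < N) : 2 ≤ critExp N s := by
  unfold critExp
  rw [le_div_iff₀ (by linarith)]
  linarith

end Translates

end MixedSobolev

/-! ### The main theorem -/

open MixedSobolev in
theorem theorem3p1 (N : ℕ) (hN : 3 ≤ N) (s : ℝ) (hs0 : 0 < s) (hs1 : s < 1)
    (q : ℝ) (hq1 : MixedSobolev.critExp N s < q) (hq2 : q < MixedSobolev.critExp N 1)
    (u : ℕ → EuclideanSpace ℝ (Fin N) → ℝ)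
    (hu : ∀ n, MixedSobolev.MemX s (u n))
    (hbdd : ∃ C : ℝ≥0, ∀ n, MixedSobolev.xNorm s (u n) ≤ C)
    (hlim : ∃ L : ℝ≥0∞, 0 < L ∧ Tendsto (fun n => ∫⁻ x, ‖u n x‖ₑ ^ q) atTop (𝓝 L)) :
    ∃ (z : ℕ → EuclideanSpace ℝ (Fin N)) (j : ℕ → ℕ) (w : EuclideanSpace ℝ (Fin N) → ℝ),
      StrictMono j ∧
      (∀ K : Set (EuclideanSpace ℝ (Fin N)), IsCompact K →
        MemLp w (ENNReal.ofReal q) (volume.restrict K)) ∧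
      ¬ (w =ᵐ[volume] 0) ∧
      ∀ K : Set (EuclideanSpace ℝ (Fin N)), IsCompact K →
        Tendsto (fun k => eLpNorm (fun x => u (j k) (x + z (j k)) - w x)
          (ENNReal.ofReal q) (volume.restrict K)) atTop (𝓝 0) := by
  obtain ⟨C, hC⟩ := hbdd
  obtain ⟨L, hL0, hL⟩ := hlim
  have hN0 : 0 < N := by omega
  have hN3 : (3 : ℝ) ≤ N := by exact_mod_cast hN
  have hsN : 2 * s < N := by linarith
  have hq : 2 < q := (two_le_critExp hs0.le hsN).trans_lt hq1
  have hq0 : 0 < q := by linarith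
  obtain ⟨A, hA⟩ := MemX.eLpNorm_le hN (s := s) C
  -- The level-set lemmas require measurable functions, so they are applied to representatives.
  set u' : ℕ → EuclideanSpace ℝ (Fin N) → ℝ := fun n => (hu n).memLp.1.mk (u n) with hu'
  have hu'm : ∀ n, Measurable (u' n) := fun n => (hu n).memLp.1.stronglyMeasurable_mk.measurable
  have hae : ∀ n, u n =ᵐ[volume] u' n := fun n => (hu n).memLp.1.ae_eq_mk
  have hu'A : ∀ n, eLpNorm (u' n) (ENNReal.ofReal (critExp N 1)) volume ≤
      ENNReal.ofReal (A : ℝ) := fun n => by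
    rw [← eLpNorm_congr_ae (hae n), ENNReal.ofReal_coe_nnreal]
    exact hA _ (hu n) (hC n)
  have hu'E : ∀ n, gagliardoEnergy s (u' n) ≤ ENNReal.ofReal ((C : ℝ) ^ 2) := fun n => by
    rw [← gagliardoEnergy_congr_ae (hae n), ENNReal.ofReal_pow C.coe_nonneg,
      ENNReal.ofReal_coe_nnreal]
    exact (energies_le_of_xNorm_le (hC n)).2
  obtain ⟨η, hη0, hηL⟩ := ENNReal.lt_iff_exists_nnreal_btwn.1 hL0
  obtain ⟨ε, R, hε, hR, hconc⟩ := exists_concentration hN0 hs0 hsN hq0 hq1 hq2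
    (E := (C : ℝ) ^ 2) (A := A) (η := η) (by positivity) A.coe_nonneg (by exact_mod_cast hη0)
  obtain ⟨n₀, hn₀⟩ := eventually_atTop.1 (hL.eventually_const_le hηL)
  -- The lower bound `η` holds only from `n₀` on. Earlier centres are arbitrary, and the sequence is
  -- shifted by `n₀` below.
  have hz : ∀ n, ∃ z, n₀ ≤ n → volume (Metric.ball z R) / 2 <
      volume (Metric.ball z R ∩ {y | ε < |u' n y|}) := by
    intro n
    by_cases hn : n₀ ≤ n
    · obtain ⟨z, hz⟩ := hconc (u' n) (hu'm n) (hu'A n) (hu'E n) (by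
        rw [ENNReal.ofReal_coe_nnreal]
        refine (hn₀ n hn).trans (le_of_eq (lintegral_congr_ae ?_))
        filter_upwards [hae n] with x hx
        rw [hx])
      exact ⟨z, fun _ => hz⟩
    · exact ⟨0, fun h => absurd h hn⟩
  choose z hz using hz
  obtain ⟨j, w, hj, hjw⟩ := exists_subseq_tendsto_Lp_loc hN0 hs0 (q := q)
    (r := critExp N 1) (E := (C : ℝ) ^ 2) (A := A) (by linarith) hq2 A.coe_nonneg
    (v := fun n x => u' (n + n₀) (x + z (n + n₀)))
    (fun n => (hu'm _).comp (measurable_add_const _))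
    (fun n => by
      have := eLpNorm_comp_measurePreserving (p := ENNReal.ofReal (critExp N 1))
        (hu'm (n + n₀)).aestronglyMeasurable
        (measurePreserving_add_right (volume : Measure (EuclideanSpace ℝ (Fin N))) (z (n + n₀)))
      exact this.le.trans (hu'A _))
    (fun n => (gagliardoEnergy_translate (u' (n + n₀)) (z (n + n₀))).le.trans (hu'E _))
  refine ⟨z, fun k => j k + n₀, w, fun a b hab => Nat.add_lt_add_right (hj hab) n₀,
    fun K hK => (hjw K hK).1, fun hw0 => ?_, fun K hK => ?_⟩
  · have hball : IsCompact (Metric.closedBall (0 : EuclideanSpace ℝ (Fin N)) R) :=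
      isCompact_closedBall 0 R
    have hlim0 := ((hjw _ hball).2).ennrpow_const q
    rw [ENNReal.zero_rpow_of_pos hq0] at hlim0
    have hb2 : 0 < volume (Metric.ball (0 : EuclideanSpace ℝ (Fin N)) R) / 2 :=
      ENNReal.half_pos (Metric.measure_ball_pos _ _ hR).ne'
    have hκ : 0 < ENNReal.ofReal ε ^ q *
        (volume (Metric.ball (0 : EuclideanSpace ℝ (Fin N)) R) / 2) :=
      ENNReal.mul_pos (ENNReal.rpow_pos (ENNReal.ofReal_pos.2 hε) (by simp)).ne' hb2.ne'
    -- If `w = 0` a.e., the `q`-th powers of the norms on the ball tend to 0, yet Chebyshev keeps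
    -- them above `ε^q` times half its volume.
    refine hκ.not_ge (ge_of_tendsto' hlim0 fun k => ?_)
    set n := j k + n₀
    have hvm : Measurable fun x => u' n (x + z n) := (hu'm n).comp (measurable_add_const _)
    have h1 := mul_meas_ge_le_pow_eLpNorm'
      (volume.restrict (Metric.closedBall (0 : EuclideanSpace ℝ (Fin N)) R))
      (p := ENNReal.ofReal q) (by simpa using hq0) (by simp) hvm.aestronglyMeasurable
      (ENNReal.ofReal ε)
    rw [ENNReal.toReal_ofReal hq0.le] at h1
    have h2 : eLpNorm (fun x => u' n (x + z n) - w x) (ENNReal.ofReal q)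
        (volume.restrict (Metric.closedBall 0 R)) =
        eLpNorm (fun x => u' n (x + z n)) (ENNReal.ofReal q)
        (volume.restrict (Metric.closedBall 0 R)) := by
      refine eLpNorm_congr_ae (ae_restrict_of_ae ?_)
      filter_upwards [hw0] with x hx
      simp [hx]
    rw [h2]
    refine le_trans ?_ h1
    gcongr
    have h3 : (fun x => x + z n) ⁻¹' (Metric.ball (z n) R ∩ {y | ε < |u' n y|}) ⊆
        {x | ENNReal.ofReal ε ≤ ‖u' n (x + z n)‖ₑ} ∩ Metric.closedBall 0 R := by
      intro x hx
      refine ⟨?_, ?_⟩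
      · have : ε < |u' n (x + z n)| := hx.2
        rw [Set.mem_ofPred_eq, Real.enorm_eq_ofReal_abs]
        exact ENNReal.ofReal_le_ofReal this.le
      · have : dist (x + z n) (z n) < R := hx.1
        rw [Metric.mem_closedBall]
        simpa using this.le
    have h4 := hz n (Nat.le_add_left _ _)
    -- The volume formula is applied forwards and backwards to move the centre from `z n` to 0.
    rw [← measure_preimage_add_right volume (z n)
      (Metric.ball (z n) R ∩ {y | ε < |u' n y|}), volume_ball_eq hN0 _ hR.le,
      ← volume_ball_eq hN0 0 hR.le] at h4
    rw [Measure.restrict_apply (measurableSet_le measurable_const hvm.enorm)]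
    exact h4.le.trans (measure_mono h3)
  · refine (hjw K hK).2.congr fun k => eLpNorm_congr_ae (ae_restrict_of_ae ?_)
    have := (measurePreserving_add_right (volume : Measure (EuclideanSpace ℝ (Fin N)))
      (z (j k + n₀))).quasiMeasurePreserving.ae (hae (j k + n₀))
    filter_upwards [this] with x hx
    rw [hx]
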